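/- All graphs are finite and simple (no loops, no multiple edges). An edge covering of a graph $G=(V,E)$ is a subset $E'\subseteq E$ such that every vertex of $G$ is incident to at least one edge of $E'$. Then: 1. No bipartite graph, connected or not, has exactly $19$, $37$, $41$, $59$ or $67$ edge coverings. 2. For every integer $n$ with $1\le n\le 1000$ and $n\notin\{19, 37, 41, 59, 67, 82, 97, 149, 197, 223, 257, 291, 379\}$ there is a connected bipartite graph with exactly $n$ edge coverings. (Nothing is asserted here about whether $82, 97, 149, 197, 223, 257, 291$ and $379$ are numbers of edge coverings of bipartite graphs.) -/

import Mathlib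

/-- `S` is an edge covering of `G`: a set of edges of `G` such that every vertex of `G` is incident
to at least one edge from `S`. -/
def SimpleGraph.IsEdgeCovering {V : Type*} (G : SimpleGraph V) (S : Set (Sym2 V)) : Prop :=
  S ⊆ G.edgeSet ∧ ∀ v : V, ∃ e ∈ S, v ∈ e

/-- The number of edge coverings of `G`. -/
noncomputable def SimpleGraph.numEdgeCoverings {V : Type*} (G : SimpleGraph V) : ℕ :=
  {S : Set (Sym2 V) | G.IsEdgeCovering S}.ncard

/-!
Both parts rest on `coverCount A D`, the number of subsets of an edge set `A` that cover the
vertices of `D`, and on its deletion–contraction rule `coverCount_eq_add`.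

*Numbers that are not attained.* If some vertex of `D` has at most one edge, the count is zero, or
that edge is forced and `D` becomes smaller. Otherwise every vertex of `D` has at least two edges.
Such a graph is explored vertex by vertex: one chooses a vertex, guesses its edges one at a time,
and keeps track of how often each set of labelled vertices is covered by subsets of the edges seen
so far. By `value_grow` this formal sum always determines the count. The number of chosen subsets
that can be completed by taking all remaining edges is a lower bound for the count
(`weight_le_value`). With minimum degree two it grows so quickly that only finitely many branches
stay at 67 or below, and these are enumerated by `search_half` and `search_extend`. When the
component of the initial vertex is complete, the count is the product of the counts of this
component and of the rest. The search shows that the first factor is neither 1 nor one of the five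
primes in question, so the product is none of these primes (`value_notMem_badCounts`).

*Numbers that are attained.* Each rooted connected bipartite graph gets the pair `(t, n)`, where
`n` counts its edge coverings, and `t` the edge sets that may leave the root uncovered. Connecting
two roots by an edge acts on these pairs by the operation `⋈` (`Realizable.bridge`). Starting from
a single vertex and sixteen small graphs with cycles (`IsGadget`), repeated use of this operation
yields every claimed number, which is verified by the computation `reach_seeds`.
-/

open Finset

/-! ### Counting edge sets that cover a given set of vertices -/

section CoverCount
variable {V W : Type*} [DecidableEq V] [DecidableEq W]

/-- The number of subsets of the edge set `A` that cover every vertex of `D`. Vertices outside `D`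
impose no condition, so an edge with one end outside `D` acts as a half-edge. -/
def coverCount (A : Finset (Sym2 V)) (D : Finset V) : ℕ :=
  #{S ∈ A.powerset | ∀ v ∈ D, ∃ e ∈ S, v ∈ e}

/-- Deletion–contraction: a subset of `A` either avoids `e`, or contains `e`, which then covers
both of its ends. -/
theorem coverCount_eq_add {A : Finset (Sym2 V)} {e : Sym2 V} (he : e ∈ A) (D : Finset V) :
    coverCount A D = coverCount (A.erase e) D + coverCount (A.erase e) {v ∈ D | v ∉ e} := by
  conv_lhs => rw [coverCount, ← insert_erase he]
  rw [powerset_insert, filter_union, card_union_of_disjoint]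
  · congr 1
    rw [filter_image, card_image_of_injOn]
    · refine congrArg card (filter_congr fun S _ => ?_)
      simp only [mem_insert, exists_eq_or_imp, mem_filter]
      exact ⟨fun h v hv => (h v hv.1).resolve_left hv.2, fun h v hv => by
        by_cases hve : v ∈ e
        · exact Or.inl hve
        · exact Or.inr (h v ⟨hv, hve⟩)⟩
    · intro S hS T hT h
      have hS' : e ∉ S := fun h => by simpa using mem_powerset.1 (mem_filter.1 hS).1 h
      have hT' : e ∉ T := fun h => by simpa using mem_powerset.1 (mem_filter.1 hT).1 h
      rw [← erase_insert hS', ← erase_insert hT']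
      exact congrArg (·.erase e) h
  · refine disjoint_filter_filter (disjoint_left.2 fun S hS hS' => ?_)
    obtain ⟨T, -, rfl⟩ := mem_image.1 hS'
    simpa using mem_powerset.1 hS (mem_insert_self e T)

theorem coverCount_pos {A : Finset (Sym2 V)} {D : Finset V} (h : ∀ v ∈ D, ∃ e ∈ A, v ∈ e) :
    0 < coverCount A D :=
  card_pos.2 ⟨A, mem_filter.2 ⟨mem_powerset_self A, h⟩⟩

theorem coverCount_eq_zero {A : Finset (Sym2 V)} {D : Finset V} {v : V} (hv : v ∈ D)
    (h : ∀ e ∈ A, v ∉ e) : coverCount A D = 0 :=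
  card_eq_zero.2 <| filter_eq_empty_iff.2 fun _ hS hD =>
    let ⟨e, he, hve⟩ := hD v hv
    h e (mem_powerset.1 hS he) hve

theorem coverCount_empty_right (A : Finset (Sym2 V)) : coverCount A ∅ = 2 ^ #A := by
  simp [coverCount]

theorem coverCount_empty_left (D : Finset V) : coverCount ∅ D = if D = ∅ then 1 else 0 := by
  split_ifs with h
  · simp [h, coverCount]
  · obtain ⟨v, hv⟩ := nonempty_iff_ne_empty.2 h
    exact coverCount_eq_zero hv (by simp)

/-- If no edge of either part meets the vertices to be covered by the other part, the count is
multiplicative. -/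
theorem coverCount_union {A₁ A₂ : Finset (Sym2 V)} {D₁ D₂ : Finset V} (hA : Disjoint A₁ A₂)
    (h₁ : ∀ e ∈ A₁, ∀ v ∈ D₂, v ∉ e) (h₂ : ∀ e ∈ A₂, ∀ v ∈ D₁, v ∉ e) :
    coverCount (A₁ ∪ A₂) (D₁ ∪ D₂) = coverCount A₁ D₁ * coverCount A₂ D₂ := by
  induction A₁ using Finset.induction_on generalizing D₁ with
  | empty =>
    rw [empty_union, coverCount_empty_left]
    split_ifs with h
    · rw [h, empty_union, one_mul]
    · obtain ⟨v, hv⟩ := nonempty_iff_ne_empty.2 h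
      rw [zero_mul]
      exact coverCount_eq_zero (mem_union_left _ hv) fun e he => h₂ e he v hv
  | insert e A he ih =>
    have hA' := disjoint_insert_left.1 hA
    have hD : ({v ∈ D₁ ∪ D₂ | v ∉ e} : Finset V) = {v ∈ D₁ | v ∉ e} ∪ D₂ := by
      rw [filter_union, filter_true_of_mem fun v hv => h₁ e (mem_insert_self ..) v hv]
    have h₁' : ∀ e ∈ A, ∀ v ∈ D₂, v ∉ e := fun e' he' => h₁ e' (mem_insert_of_mem he')
    rw [coverCount_eq_add (mem_insert_self e A), insert_union,
      coverCount_eq_add (mem_insert_self e (A ∪ A₂)), erase_insert he,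
      erase_insert (by simp [he, hA'.1]), hD, ih hA'.2 h₁' h₂,
      ih hA'.2 h₁' fun e' he' v hv => h₂ e' he' v (mem_filter.1 hv).1, add_mul]

theorem coverCount_image {f : V → W} (hf : Function.Injective f) (A : Finset (Sym2 V))
    (D : Finset V) : coverCount (A.image (Sym2.map f)) (D.image f) = coverCount A D := by
  induction A using Finset.induction_on generalizing D with
  | empty => simp [coverCount_empty_left]
  | insert e A he ih =>
    have hD : ({v ∈ D.image f | v ∉ Sym2.map f e} : Finset W) =
        ({v ∈ D | v ∉ e} : Finset V).image f := by
      rw [filter_image]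
      refine congrArg _ (filter_congr fun v _ => ?_)
      simp [Sym2.mem_map, hf.eq_iff]
    rw [coverCount_eq_add (mem_insert_self e A), image_insert,
      coverCount_eq_add (mem_insert_self _ _), erase_insert he, erase_insert, hD, ih, ih]
    rw [mem_image]
    rintro ⟨e', he', h⟩
    exact he (Sym2.map.injective hf h ▸ he')

theorem numEdgeCoverings_eq_coverCount [Fintype V] (G : SimpleGraph V) [Fintype G.edgeSet] :
    G.numEdgeCoverings = coverCount G.edgeFinset univ := by
  have h : {S : Set (Sym2 V) | G.IsEdgeCovering S} =
      (fun S : Finset (Sym2 V) => (S : Set (Sym2 V))) ''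
      ({S ∈ G.edgeFinset.powerset | ∀ v ∈ (univ : Finset V), ∃ e ∈ S, v ∈ e} :
        Finset (Finset (Sym2 V))) := by
    ext S
    simp only [SimpleGraph.IsEdgeCovering, Set.mem_ofPred_eq, Set.mem_image, coe_filter,
      mem_powerset, mem_univ, true_imp_iff]
    constructor
    · rintro ⟨hS, hv⟩
      have hfin : S.Finite := G.edgeSet.toFinite.subset hS
      refine ⟨hfin.toFinset, ⟨fun e he => ?_, ?_⟩, by simp⟩
      · exact SimpleGraph.mem_edgeFinset.2 (hS (hfin.mem_toFinset.1 he))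
      · simpa using hv
    · rintro ⟨T, ⟨hT, hv⟩, rfl⟩
      exact ⟨fun e he => SimpleGraph.mem_edgeFinset.1 (hT he), hv⟩
  rw [SimpleGraph.numEdgeCoverings, h, Set.ncard_image_of_injective _ coe_injective,
    Set.ncard_coe_finset, coverCount]
  congr!

end CoverCount

/-! ### The exploration of bipartite graphs with few coverings -/

/-- Lists of pairs `(m, a)` encode formal sums of bit masks: `m` is the set of labels covered so
far, and `a` the number of ways in which this set arises. `addTerm m a L` adds `a` times the mask
`m` to `L`, merging it with an entry for `m` if there is one. -/
def addTerm (m a : ℕ) : List (ℕ × ℕ) → List (ℕ × ℕ)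
  | [] => [(m, a)]
  | p :: L => bif Nat.beq m p.1 then (m, p.2 + a) :: L else p :: addTerm m a L

/-- `grow b L R` adds to `R` the formal sum `L` with the labels of `b` united to each of its masks.
Thus `grow b L L` is the effect of deciding about an edge with end set `b`: the summand `R = L`
stands for leaving the edge out, the other one for taking it. -/
def grow (b : ℕ) : List (ℕ × ℕ) → List (ℕ × ℕ) → List (ℕ × ℕ)
  | [], R => R
  | p :: L, R => grow b L (addTerm (p.1 ||| b) p.2 R)

/-- The total multiplicity of the masks that contain `need`. -/
def weight (need : ℕ) : List (ℕ × ℕ) → ℕ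
  | [] => 0
  | p :: L => bif Nat.beq (need &&& p.1) need then p.2 + weight need L else weight need L

/-- The part of a formal sum in which the label `u` is covered. -/
def keep (u : ℕ) (L : List (ℕ × ℕ)) : List (ℕ × ℕ) := L.filter (·.1.testBit u)

/-- Exploration, label by label, of the bipartite graphs with a small number of coverings; the
value `true` means that the exploration ends within the fuel, the first argument, without meeting a
component with 1, 19, 37, 41, 59 or 67 coverings. The other arguments are the number `k` of labels
in use, the mask `need` of labels that are not known to have further edges, the current label `u`
with its colour `c`, the formal sum `L` of covered sets, and the queue `F` of open labels with
their colours. The last argument says which edges of `u` are still to be guessed: `none` stands for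
all of them, where edges leaving the set of vertices to be covered come first, `some R` for edges
to labels in `R` or to unlabelled vertices. A branch is cut as soon as the weight exceeds 67. An
unlabelled vertex receives the label `k`; a label whose edges are used up is closed, and then only
the masks that contain it survive. -/
def search : ℕ → ℕ → ℕ → ℕ → Bool → List (ℕ × ℕ) → List (ℕ × Bool) →
    Option (List (ℕ × Bool)) → Bool
  | 0, _, _, _, _, _, _, _ => false
  | n + 1, k, need, u, c, L, F, none =>
    search n k need u c L F (some F) &&
      (Nat.blt 67 (weight (need ||| 2 ^ u) (grow (2 ^ u) L L)) ||
        search n k (need ||| 2 ^ u) u c (grow (2 ^ u) L L) F none)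
  | n + 1, k, need, u, c, L, F, some (w :: R) =>
    search n k need u c L F (some R) &&
      (c == w.2 ||
        Nat.blt 67 (weight (need ||| (2 ^ u ||| 2 ^ w.1)) (grow (2 ^ u ||| 2 ^ w.1) L L)) ||
        search n k (need ||| (2 ^ u ||| 2 ^ w.1)) u c (grow (2 ^ u ||| 2 ^ w.1) L L) F (some R))
  | n + 1, k, need, u, c, L, F, some [] =>
    (Nat.blt 67 (weight (need ||| 2 ^ u) (grow (2 ^ u ||| 2 ^ k) L L)) ||
        search n (k + 1) (need ||| 2 ^ u) u c (grow (2 ^ u ||| 2 ^ k) L L) (F ++ [(k, !c)])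
          (some [])) &&
      (!need.testBit u ||
        match F with
        | [] => !([1, 19, 37, 41, 59, 67].contains (weight (2 ^ u) L))
        | w :: F => search n k need w.1 w.2 (keep u L) F none)

set_option maxRecDepth 100000 in
/-- No bad count occurs when the first edge of the initial vertex leaves the set to be covered. -/
theorem search_half : search 100 1 0 0 false (grow 1 [(0, 1)] [(0, 1)]) [] none = true := by
  decide +kernel

set_option maxRecDepth 100000 in
/-- No bad count occurs when the first edge of the initial vertex leads to a second vertex, and all
its edges stay in the set to be covered. -/
theorem search_extend :
    search 100 2 0 0 false (grow 3 [(0, 1)] [(0, 1)]) [(1, true)] (some []) = true := by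
  decide +kernel

/-! ### The number of coverings counted by a formal sum -/

section Value
variable {V : Type*}

open Classical in
/-- The vertices of `D` that carry no label from the mask `m`, where `f i` is the vertex labelled
`i`. -/
noncomputable def uncovered (f : ℕ → V) (D : Finset V) (m : ℕ) : Finset V :=
  {v ∈ D | ∀ i, m.testBit i = true → f i ≠ v}

theorem mem_uncovered {f : ℕ → V} {D : Finset V} {m : ℕ} {v : V} :
    v ∈ uncovered f D m ↔ v ∈ D ∧ ∀ i, m.testBit i = true → f i ≠ v := by
  simp [uncovered]

theorem uncovered_update {f : ℕ → V} {D : Finset V} {k m : ℕ} (hm : m < 2 ^ k) (x : V) :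
    uncovered (Function.update f k x) D m = uncovered f D m := by
  ext v
  simp only [mem_uncovered]
  refine and_congr_right fun _ => forall_congr' fun i => imp_congr_right fun hi => ?_
  rw [Function.update_of_ne]
  rintro rfl
  exact absurd (Nat.testBit_lt_two_pow hm) (by simp [hi])

variable [DecidableEq V]

/-- The number of coverings counted by a state of the exploration: each mask of the formal sum `L`
contributes its multiplicity times the number of subsets of the remaining edges `A` that cover what
the mask leaves uncovered. -/
noncomputable def value (f : ℕ → V) (A : Finset (Sym2 V)) (D : Finset V) (L : List (ℕ × ℕ)) : ℕ :=
  (L.map fun p => p.2 * coverCount A (uncovered f D p.1)).sum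

variable {f : ℕ → V} {A : Finset (Sym2 V)} {D : Finset V}

theorem value_cons (p : ℕ × ℕ) (L : List (ℕ × ℕ)) :
    value f A D (p :: L) = p.2 * coverCount A (uncovered f D p.1) + value f A D L := by
  simp [value]

theorem value_addTerm (m a : ℕ) (L : List (ℕ × ℕ)) :
    value f A D (addTerm m a L) = a * coverCount A (uncovered f D m) + value f A D L := by
  induction L with
  | nil => simp [addTerm, value]
  | cons p L ih =>
    rw [addTerm, cond_eq_ite]
    split_ifs with h
    · rw [Nat.beq_eq] at h
      rw [value_cons, value_cons, h]
      ring
    · rw [value_cons, value_cons, ih]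
      ring

/-- Deciding about one edge `e` preserves the value, by deletion–contraction in each summand. -/
theorem value_grow {e : Sym2 V} (he : e ∈ A) {b : ℕ} {L : List (ℕ × ℕ)}
    (h : ∀ p ∈ L, uncovered f D (p.1 ||| b) = {v ∈ uncovered f D p.1 | v ∉ e}) :
    value f (A.erase e) D (grow b L L) = value f A D L := by
  suffices H : ∀ L R : List (ℕ × ℕ),
      (∀ p ∈ L, uncovered f D (p.1 ||| b) = {v ∈ uncovered f D p.1 | v ∉ e}) →
      value f (A.erase e) D (grow b L R) + value f (A.erase e) D L =
        value f A D L + value f (A.erase e) D R by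
    have := H L L h
    lia
  intro L
  induction L with
  | nil => simp [grow, value]
  | cons p L ih =>
    intro R h
    have h₁ := ih (addTerm (p.1 ||| b) p.2 R) fun q hq => h q (List.mem_cons_of_mem _ hq)
    rw [value_addTerm, h p List.mem_cons_self] at h₁
    rw [grow, value_cons, value_cons, coverCount_eq_add he]
    linarith

theorem mask_lt_of_mem_grow {b k : ℕ} (hb : b < 2 ^ k) {L : List (ℕ × ℕ)}
    (hL : ∀ p ∈ L, p.1 < 2 ^ k) : ∀ p ∈ grow b L L, p.1 < 2 ^ k := by
  have hadd : ∀ (m a : ℕ) (R : List (ℕ × ℕ)), m < 2 ^ k → (∀ p ∈ R, p.1 < 2 ^ k) →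
      ∀ p ∈ addTerm m a R, p.1 < 2 ^ k := by
    intro m a R hm
    induction R with
    | nil => simp [addTerm, hm]
    | cons q R ih =>
      intro hR
      rw [List.forall_mem_cons] at hR
      rw [addTerm, cond_eq_ite]
      split_ifs with h
      · rw [List.forall_mem_cons]
        exact ⟨hm, hR.2⟩
      · rw [List.forall_mem_cons]
        exact ⟨hR.1, ih hR.2⟩
  suffices H : ∀ L R : List (ℕ × ℕ), (∀ p ∈ L, p.1 < 2 ^ k) → (∀ p ∈ R, p.1 < 2 ^ k) →
      ∀ p ∈ grow b L R, p.1 < 2 ^ k from H L L hL hL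
  intro L
  induction L with
  | nil => exact fun R _ h => h
  | cons p L ih =>
    intro R hL hR
    rw [List.forall_mem_cons] at hL
    exact ih _ hL.2 (hadd _ _ _ (Nat.or_lt_two_pow hL.1 hb) hR)

theorem testBit_of_and_eq {a m i : ℕ} (h : a &&& m = a) (hi : a.testBit i = true) :
    m.testBit i = true := by
  rw [← h, Nat.testBit_and] at hi
  exact (Bool.and_eq_true_iff.1 hi).2

/-- If every vertex of `D` without a label in `need` has an edge in `A`, then a mask containing
`need` can be completed to a covering by taking all of `A`. -/
theorem weight_le_value {need : ℕ} (L : List (ℕ × ℕ))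
    (h : ∀ v ∈ D, (∀ i, need.testBit i = true → f i ≠ v) → ∃ e ∈ A, v ∈ e) :
    weight need L ≤ value f A D L := by
  induction L with
  | nil => simp [weight]
  | cons p L ih =>
    rw [weight, cond_eq_ite, value_cons]
    split_ifs with hp
    · rw [Nat.beq_eq] at hp
      refine Nat.add_le_add (Nat.le_mul_of_pos_right _ (coverCount_pos fun v hv => ?_)) ih
      rw [mem_uncovered] at hv
      exact h v hv.1 fun i hi => hv.2 i (testBit_of_and_eq hp hi)
    · lia

theorem uncovered_or {e : Sym2 V} {b : ℕ}
    (h : ∀ v ∈ D, v ∈ e ↔ ∃ i, b.testBit i = true ∧ f i = v) (m : ℕ) :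
    uncovered f D (m ||| b) = {v ∈ uncovered f D m | v ∉ e} := by
  ext v
  simp only [mem_uncovered, mem_filter, Nat.testBit_or, Bool.or_eq_true_iff, and_assoc]
  refine and_congr_right fun hv => ?_
  rw [h v hv]
  exact ⟨fun h => ⟨fun i hi => h i (.inl hi), fun ⟨i, hi, hf⟩ => h i (.inr hi) hf⟩,
    fun h i hi => hi.elim (h.1 i) fun hi hf => h.2 ⟨i, hi, hf⟩⟩

end Value

/-! ### Correctness of the exploration -/

section Explored
variable {V : Type*} [DecidableEq V]

/-- The arguments of `search` describe a graph with remaining edge set `A` and set `D` of vertices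
still to be covered: `f` is injective on the labels below `k`, the labels `u` and those of `F` are
exactly the ones whose vertices lie in `D`, the colours agree with the proper colouring `col`, a
label outside `need` has a remaining edge, and an unlabelled vertex of `D` has at least two. -/
structure Explored (col : V → Bool) (f : ℕ → V) (A : Finset (Sym2 V)) (D : Finset V)
    (k need u : ℕ) (c : Bool) (L : List (ℕ × ℕ)) (F : List (ℕ × Bool)) : Prop where
  proper : ∀ a b, s(a, b) ∈ A → col a ≠ col b
  mask_lt : ∀ p ∈ L, p.1 < 2 ^ k
  inj : ∀ i < k, ∀ j < k, f i = f j → i = j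
  nodup : (((u, c) :: F).map Prod.fst).Nodup
  lt : ∀ p ∈ (u, c) :: F, p.1 < k
  mem : ∀ p ∈ (u, c) :: F, f p.1 ∈ D
  color : ∀ p ∈ (u, c) :: F, col (f p.1) = p.2
  edge : ∀ p ∈ (u, c) :: F, need.testBit p.1 = false → ∃ e ∈ A, f p.1 ∈ e
  active : ∀ i < k, f i ∈ D → ∃ p ∈ (u, c) :: F, p.1 = i
  fresh : ∀ v ∈ D, (∀ i < k, f i ≠ v) → 2 ≤ #{e ∈ A | v ∈ e}

/-- The last argument of `search` is compatible with the graph: for `some R`, each remaining edge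
of `f u` stays in `D` and leads to an unlabelled vertex or to a label in `R`. -/
def Phase (f : ℕ → V) (A : Finset (Sym2 V)) (D : Finset V) (k u : ℕ) (F : List (ℕ × Bool)) :
    Option (List (ℕ × Bool)) → Prop
  | none => True
  | some R => R ⊆ F ∧ ∀ x, s(f u, x) ∈ A →
      x ∈ D ∧ ((∀ i < k, f i ≠ x) ∨ ∃ p ∈ R, f p.1 = x)

variable {col : V → Bool} {f : ℕ → V} {A : Finset (Sym2 V)} {D : Finset V}
  {k need u : ℕ} {c : Bool} {L : List (ℕ × ℕ)} {F : List (ℕ × Bool)}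

theorem Phase.erase {e : Sym2 V} {R : Option (List (ℕ × Bool))} (h : Phase f A D k u F R) :
    Phase f (A.erase e) D k u F R := by
  cases R with
  | none => trivial
  | some R => exact ⟨h.1, fun x hx => h.2 x (mem_of_mem_erase hx)⟩

namespace Explored

theorem weight_le (h : Explored col f A D k need u c L F) : weight need L ≤ value f A D L := by
  refine weight_le_value L fun v hv hneed => ?_
  by_cases hfresh : ∀ i < k, f i ≠ v
  · have h₂ := h.fresh v hv hfresh
    obtain ⟨e, he⟩ := card_pos.1 (by lia : 0 < #{e ∈ A | v ∈ e})
    exact ⟨e, mem_filter.1 he⟩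
  · push Not at hfresh
    obtain ⟨i, hi, rfl⟩ := hfresh
    obtain ⟨p, hp, rfl⟩ := h.active i hi hv
    exact h.edge p hp (Bool.eq_false_iff.2 fun hb => hneed _ hb rfl)

/-- Removing a remaining edge `e` keeps the description valid, if no unlabelled vertex of `D` is an
end of `e`, and each label outside the new `need` retains an edge. -/
theorem erase (h : Explored col f A D k need u c L F) {e : Sym2 V}
    {need' b : ℕ} (hb : b < 2 ^ k) (hfresh : ∀ v ∈ D, (∀ i < k, f i ≠ v) → v ∉ e)
    (hneed : ∀ p ∈ (u, c) :: F, need'.testBit p.1 = false →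
      need.testBit p.1 = false ∧ (f p.1 ∈ e → ∃ e' ∈ A.erase e, f p.1 ∈ e')) :
    Explored col f (A.erase e) D k need' u c (grow b L L) F where
  proper a b hab := h.proper a b (mem_of_mem_erase hab)
  mask_lt := mask_lt_of_mem_grow hb h.mask_lt
  inj := h.inj
  nodup := h.nodup
  lt := h.lt
  mem := h.mem
  color := h.color
  active := h.active
  edge p hp hp' := by
    obtain ⟨h₁, h₂⟩ := hneed p hp hp'
    by_cases hpe : f p.1 ∈ e
    · exact h₂ hpe
    · obtain ⟨e', he', hpe'⟩ := h.edge p hp h₁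
      exact ⟨e', mem_erase.2 ⟨fun heq => hpe (heq ▸ hpe'), he'⟩, hpe'⟩
  fresh v hv hv' := by
    have : ({e' ∈ A.erase e | v ∈ e'} : Finset (Sym2 V)) = {e' ∈ A | v ∈ e'} := by
      rw [filter_erase, erase_eq_of_notMem]
      exact fun hmem => hfresh v hv hv' (mem_filter.1 hmem).2
    rw [this]
    exact h.fresh v hv hv'

theorem u_lt (h : Explored col f A D k need u c L F) : u < k := h.lt _ List.mem_cons_self
theorem u_mem (h : Explored col f A D k need u c L F) : f u ∈ D := h.mem _ List.mem_cons_self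
theorem u_color (h : Explored col f A D k need u c L F) : col (f u) = c :=
  h.color _ List.mem_cons_self

theorem testBit_or_two_pow_eq_false {P : Prop} (need u i : ℕ)
    (h : (need ||| 2 ^ u).testBit i = false) : need.testBit i = false ∧ (i = u → P) := by
  rw [Nat.testBit_or, Nat.testBit_two_pow, Bool.or_eq_false_iff, decide_eq_false_iff_not] at h
  exact ⟨h.1, fun hi => absurd hi.symm h.2⟩

/-- The step along an edge from the current vertex to a vertex outside `D`. -/
theorem half (h : Explored col f A D k need u c L F) {x : V} (hx : s(f u, x) ∈ A) (hxD : x ∉ D)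
    {need' : ℕ} (hneed : ∀ i, need'.testBit i = false → need.testBit i = false ∧
      (i = u → ∃ e ∈ A.erase s(f u, x), f u ∈ e)) :
    Explored col f (A.erase s(f u, x)) D k need' u c (grow (2 ^ u) L L) F ∧
      value f (A.erase s(f u, x)) D (grow (2 ^ u) L L) = value f A D L := by
  refine ⟨h.erase (Nat.pow_lt_pow_right one_lt_two h.u_lt) ?_ ?_,
    value_grow hx fun p _ => uncovered_or ?_ _⟩
  · rintro v hv hv' hve
    rcases Sym2.mem_iff.1 hve with rfl | rfl
    · exact hv' u h.u_lt rfl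
    · exact hxD hv
  · intro p hp hbit
    refine ⟨(hneed _ hbit).1, fun hpe => ?_⟩
    rcases Sym2.mem_iff.1 hpe with heq | heq
    · exact heq ▸ (hneed _ hbit).2 (h.inj _ (h.lt p hp) _ h.u_lt heq)
    · exact absurd (heq ▸ h.mem p hp) hxD
  · intro v hv
    simp only [Sym2.mem_iff, Nat.testBit_two_pow, decide_eq_true_eq]
    constructor
    · rintro (rfl | rfl)
      · exact ⟨u, rfl, rfl⟩
      · exact absurd hv hxD
    · rintro ⟨i, rfl, rfl⟩
      exact Or.inl rfl

/-- The step along an edge from the current vertex to a label of the queue. -/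
theorem join (h : Explored col f A D k need u c L F) {w : ℕ × Bool} (hw : w ∈ F)
    (hx : s(f u, f w.1) ∈ A) :
    Explored col f (A.erase s(f u, f w.1)) D k (need ||| (2 ^ u ||| 2 ^ w.1)) u c
        (grow (2 ^ u ||| 2 ^ w.1) L L) F ∧
      value f (A.erase s(f u, f w.1)) D (grow (2 ^ u ||| 2 ^ w.1) L L) = value f A D L := by
  have hwk := h.lt w (List.mem_cons_of_mem _ hw)
  refine ⟨h.erase (Nat.or_lt_two_pow (Nat.pow_lt_pow_right one_lt_two h.u_lt)
    (Nat.pow_lt_pow_right one_lt_two hwk)) ?_ ?_, value_grow hx fun p _ => uncovered_or ?_ _⟩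
  · rintro v hv hv' hve
    rcases Sym2.mem_iff.1 hve with rfl | rfl
    · exact hv' u h.u_lt rfl
    · exact hv' w.1 hwk rfl
  · intro p hp hbit
    simp only [Nat.testBit_or, Nat.testBit_two_pow, Bool.or_eq_false_iff,
      decide_eq_false_iff_not] at hbit
    refine ⟨hbit.1, fun hpe => ?_⟩
    rcases Sym2.mem_iff.1 hpe with heq | heq
    · exact absurd (h.inj _ (h.lt p hp) _ h.u_lt heq).symm hbit.2.1
    · exact absurd (h.inj _ (h.lt p hp) _ hwk heq).symm hbit.2.2
  · intro v hv
    simp only [Sym2.mem_iff, Nat.testBit_or, Nat.testBit_two_pow, Bool.or_eq_true_iff,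
      decide_eq_true_eq]
    constructor
    · rintro (rfl | rfl)
      · exact ⟨u, .inl rfl, rfl⟩
      · exact ⟨w.1, .inr rfl, rfl⟩
    · rintro ⟨i, rfl | rfl, rfl⟩
      · exact Or.inl rfl
      · exact Or.inr rfl

theorem value_update (hL : ∀ p ∈ L, p.1 < 2 ^ k) (x : V) :
    value (Function.update f k x) A D L = value f A D L := by
  rw [value, value]
  exact congrArg List.sum (List.map_congr_left fun p hp => by rw [uncovered_update (hL p hp)])

/-- An unlabelled neighbour `x` of the current vertex may be given the label `k`. -/
theorem label (h : Explored col f A D k need u c L F) {x : V} (hx : s(f u, x) ∈ A) (hxD : x ∈ D)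
    (hxf : ∀ i < k, f i ≠ x) :
    Explored col (Function.update f k x) A D (k + 1) need u c L (F ++ [(k, !c)]) := by
  have hold : ∀ i < k, Function.update f k x i = f i := fun i hi =>
    Function.update_of_ne hi.ne _ _
  have hnew : Function.update f k x k = x := Function.update_self ..
  have hsplit : ∀ p, p ∈ (u, c) :: (F ++ [(k, !c)]) ↔ p ∈ (u, c) :: F ∨ p = (k, !c) := by
    simp [or_assoc]
  exact {
    proper := h.proper
    mask_lt := fun p hp => (h.mask_lt p hp).trans (Nat.pow_lt_pow_right one_lt_two k.lt_succ_self)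
    inj := by
      intro i hi j hj hij
      rcases Nat.lt_succ_iff_lt_or_eq.1 hi with hi | rfl <;>
        rcases Nat.lt_succ_iff_lt_or_eq.1 hj with hj | rfl
      · rw [hold i hi, hold j hj] at hij
        exact h.inj i hi j hj hij
      · rw [hold i hi, hnew] at hij
        exact absurd hij (hxf i hi)
      · rw [hold j hj, hnew] at hij
        exact absurd hij.symm (hxf j hj)
      · rfl
    nodup := by
      rw [← List.cons_append, List.map_append, List.nodup_append]
      refine ⟨h.nodup, by simp, fun a ha b hb => ?_⟩
      obtain ⟨p, hp, rfl⟩ := List.mem_map.1 ha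
      simp only [List.map_cons, List.map_nil, List.mem_singleton] at hb
      exact hb ▸ (h.lt p hp).ne
    lt := by
      intro p hp
      rcases (hsplit p).1 hp with hp | rfl
      · exact (h.lt p hp).trans k.lt_succ_self
      · exact k.lt_succ_self
    mem := by
      intro p hp
      rcases (hsplit p).1 hp with hp | rfl
      · rw [hold _ (h.lt p hp)]
        exact h.mem p hp
      · rwa [hnew]
    color := by
      intro p hp
      rcases (hsplit p).1 hp with hp | rfl
      · rw [hold _ (h.lt p hp)]
        exact h.color p hp
      · rw [hnew]
        have := h.proper _ _ hx
        rw [h.u_color] at this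
        exact Bool.eq_not.2 this.symm
    edge := by
      intro p hp hbit
      rcases (hsplit p).1 hp with hp | rfl
      · rw [hold _ (h.lt p hp)]
        exact h.edge p hp hbit
      · rw [hnew]
        exact ⟨_, hx, Sym2.mem_mk_right ..⟩
    active := by
      intro i hi hiD
      rcases Nat.lt_succ_iff_lt_or_eq.1 hi with hi | rfl
      · rw [hold i hi] at hiD
        obtain ⟨p, hp, rfl⟩ := h.active i hi hiD
        exact ⟨p, (hsplit p).2 (.inl hp), rfl⟩
      · exact ⟨_, (hsplit _).2 (.inr rfl), rfl⟩
    fresh := by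
      intro v hv hv'
      refine h.fresh v hv fun i hi => ?_
      rw [← hold i hi]
      exact hv' i (hi.trans k.lt_succ_self) }

/-- The step along an edge from the current vertex to an unlabelled vertex of `D`. That vertex has
at least two edges, so one of them remains. -/
theorem extend (h : Explored col f A D k need u c L F) {x : V} (hx : s(f u, x) ∈ A) (hxD : x ∈ D)
    (hxf : ∀ i < k, f i ≠ x) {need' : ℕ} (hneed : ∀ i, need'.testBit i = false →
      need.testBit i = false ∧ (i = u → ∃ e ∈ A.erase s(f u, x), f u ∈ e)) :
    Explored col (Function.update f k x) (A.erase s(f u, x)) D (k + 1) need' u c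
        (grow (2 ^ u ||| 2 ^ k) L L) (F ++ [(k, !c)]) ∧
      value (Function.update f k x) (A.erase s(f u, x)) D (grow (2 ^ u ||| 2 ^ k) L L) =
        value f A D L := by
  have h' := h.label hx hxD hxf
  have hu : Function.update f k x u = f u := Function.update_of_ne h.u_lt.ne _ _
  have hk : Function.update f k x k = x := Function.update_self ..
  have hvalue := value_update (f := f) (A := A) (D := D) h.mask_lt x
  have hcard := h.fresh x hxD hxf
  generalize Function.update f k x = g at h' hu hk hvalue ⊢
  rw [← hu] at hx hneed ⊢
  refine ⟨h'.erase (Nat.or_lt_two_pow (Nat.pow_lt_pow_right one_lt_two h'.u_lt)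
    (Nat.pow_lt_pow_right one_lt_two k.lt_succ_self)) ?_ ?_,
    (value_grow hx fun p _ => uncovered_or ?_ _).trans hvalue⟩
  · rintro v hv hv' hve
    rcases Sym2.mem_iff.1 hve with rfl | rfl
    · exact hv' u h'.u_lt rfl
    · exact hv' k k.lt_succ_self hk
  · intro p hp hbit
    refine ⟨(hneed _ hbit).1, fun hpe => ?_⟩
    rcases Sym2.mem_iff.1 hpe with heq | heq
    · exact heq ▸ (hneed _ hbit).2 (h'.inj _ (h'.lt p hp) _ h'.u_lt heq)
    · obtain ⟨e', he', hne⟩ := exists_mem_ne (one_lt_two.trans_le hcard) s(g u, x)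
      rw [mem_filter] at he'
      exact ⟨e', mem_erase.2 ⟨hne, he'.1⟩, heq ▸ he'.2⟩
  · intro v hv
    simp only [Sym2.mem_iff, Nat.testBit_or, Nat.testBit_two_pow, Bool.or_eq_true_iff,
      decide_eq_true_eq]
    constructor
    · rintro (rfl | rfl)
      · exact ⟨u, .inl rfl, rfl⟩
      · exact ⟨k, .inr rfl, hk⟩
    · rintro ⟨i, rfl | rfl, rfl⟩
      · exact Or.inl rfl
      · exact Or.inr hk

theorem uncovered_of_testBit (f : ℕ → V) (D : Finset V) {m : ℕ} (hu : m.testBit u = true) :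
    uncovered f D m = uncovered f (D.erase (f u)) m := by
  ext v
  simp only [mem_uncovered, mem_erase]
  exact ⟨fun h => ⟨⟨(h.2 u hu).symm, h.1⟩, h.2⟩, fun h => ⟨h.1.2, h.2⟩⟩

theorem coverCount_of_testBit_eq_false (h : Explored col f A D k need u c L F)
    (hu : ∀ e ∈ A, f u ∉ e) {m : ℕ} (hm : m < 2 ^ k) (hmu : m.testBit u = false) :
    coverCount A (uncovered f D m) = 0 := by
  refine coverCount_eq_zero (mem_uncovered.2 ⟨h.u_mem, fun i hi hiu => ?_⟩) hu
  have hik : i < k := by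
    by_contra! hki
    have := Nat.testBit_lt_two_pow (hm.trans_le (Nat.pow_le_pow_right two_pos hki))
    simp [hi] at this
  rw [h.inj i hik u h.u_lt hiu, hmu] at hi
  exact Bool.false_ne_true hi

/-- Without remaining edges at the current vertex, masks that leave it uncovered contribute
nothing. -/
theorem value_keep (h : Explored col f A D k need u c L F) (hu : ∀ e ∈ A, f u ∉ e) :
    value f A (D.erase (f u)) (keep u L) = value f A D L := by
  suffices H : ∀ L' : List (ℕ × ℕ), (∀ p ∈ L', p.1 < 2 ^ k) →
      value f A (D.erase (f u)) (keep u L') = value f A D L' from H L h.mask_lt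
  intro L'
  induction L' with
  | nil => exact fun _ => rfl
  | cons p L' ih =>
    intro hL
    rw [List.forall_mem_cons] at hL
    rw [value_cons, ← ih hL.2, keep, List.filter_cons, ← keep]
    split_ifs with hp
    · rw [value_cons, ← uncovered_of_testBit f D hp]
    · rw [h.coverCount_of_testBit_eq_false hu hL.1 (Bool.eq_false_iff.2 hp), mul_zero, zero_add]

/-- When the last open label has no edges left, the explored component splits off as a factor. -/
theorem value_nil (h : Explored col f A D k need u c L []) (hu : ∀ e ∈ A, f u ∉ e) :
    value f A D L = weight (2 ^ u) L * coverCount A (D.erase (f u)) := by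
  suffices H : ∀ L' : List (ℕ × ℕ), (∀ p ∈ L', p.1 < 2 ^ k) →
      value f A D L' = weight (2 ^ u) L' * coverCount A (D.erase (f u)) from H L h.mask_lt
  intro L'
  induction L' with
  | nil => simp [value, weight]
  | cons p L' ih =>
    intro hL
    rw [List.forall_mem_cons] at hL
    rw [value_cons, ih hL.2, weight, cond_eq_ite, Nat.two_pow_and]
    cases hp : p.1.testBit u
    · rw [h.coverCount_of_testBit_eq_false hu hL.1 hp, mul_zero, zero_add, if_neg]
      simpa using (Nat.two_pow_pos u).ne
    · have hD : uncovered f D p.1 = D.erase (f u) := by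
        rw [uncovered_of_testBit f D hp]
        ext v
        rw [mem_uncovered, and_iff_left_iff_imp]
        rintro hv i hi rfl
        have hik : i < k := by
          by_contra! hki
          have := Nat.testBit_lt_two_pow (hL.1.trans_le (Nat.pow_le_pow_right two_pos hki))
          simp [hi] at this
        obtain ⟨q, hq, rfl⟩ := h.active i hik (mem_of_mem_erase hv)
        rw [List.mem_singleton] at hq
        rw [hq] at hv
        exact notMem_erase _ _ hv
      rw [hD, if_pos (by simp), add_mul]

/-- Closing the current label and passing to the next one of the queue. -/
theorem close {w : ℕ × Bool} (h : Explored col f A D k need u c L (w :: F)) :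
    Explored col f A (D.erase (f u)) k need w.1 w.2 (keep u L) F := by
  have hne : ∀ p ∈ w :: F, p.1 ≠ u := by
    intro p hp hpu
    have := h.nodup
    rw [List.map_cons, List.nodup_cons] at this
    exact this.1 (List.mem_map.2 ⟨p, hp, hpu⟩)
  exact {
    proper := h.proper
    mask_lt := fun p hp => h.mask_lt p (List.mem_of_mem_filter hp)
    inj := h.inj
    nodup := by
      have := h.nodup
      rw [List.map_cons, List.nodup_cons] at this
      exact this.2
    lt := fun p hp => h.lt p (List.mem_cons_of_mem _ hp)
    mem := fun p hp => mem_erase.2 ⟨fun heq => hne p hp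
      (h.inj _ (h.lt p (List.mem_cons_of_mem _ hp)) _ h.u_lt heq),
      h.mem p (List.mem_cons_of_mem _ hp)⟩
    color := fun p hp => h.color p (List.mem_cons_of_mem _ hp)
    edge := fun p hp => h.edge p (List.mem_cons_of_mem _ hp)
    active := by
      intro i hi hiD
      rw [mem_erase] at hiD
      obtain ⟨p, hp, rfl⟩ := h.active i hi hiD.2
      rcases List.mem_cons.1 hp with rfl | hp
      · exact absurd rfl hiD.1
      · exact ⟨p, hp, rfl⟩
    fresh := fun v hv => h.fresh v (mem_of_mem_erase hv) }

theorem phase_start (h : Explored col f A D k need u c L F) (hD : ∀ x, s(f u, x) ∈ A → x ∈ D) :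
    Phase f A D k u F (some F) := by
  refine ⟨List.Subset.refl F, fun x hx => ⟨hD x hx, ?_⟩⟩
  by_contra! hx'
  obtain ⟨⟨i, hi, rfl⟩, hF⟩ := hx'
  obtain ⟨p, hp, rfl⟩ := h.active i hi (hD _ hx)
  rcases List.mem_cons.1 hp with rfl | hp
  · exact h.proper _ _ hx rfl
  · exact hF p hp rfl

end Explored

/-- The defining equation of `search` at `some []`, uniformly in the queue. -/
theorem search_some_nil (n k need u : ℕ) (c : Bool) (L : List (ℕ × ℕ)) (F : List (ℕ × Bool)) :
    search (n + 1) k need u c L F (some []) =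
      ((Nat.blt 67 (weight (need ||| 2 ^ u) (grow (2 ^ u ||| 2 ^ k) L L)) ||
        search n (k + 1) (need ||| 2 ^ u) u c (grow (2 ^ u ||| 2 ^ k) L L) (F ++ [(k, !c)])
          (some [])) &&
      (!need.testBit u ||
        match F with
        | [] => !([1, 19, 37, 41, 59, 67].contains (weight (2 ^ u) L))
        | w :: F => search n k need w.1 w.2 (keep u L) F none)) := by
  cases F <;> rw [search]

/-- Five primes none of which is the number of edge coverings of a bipartite graph. -/
def badCounts : List ℕ := [19, 37, 41, 59, 67]

/-- A successful search excludes the bad counts for every graph that its arguments describe. Along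
the branch followed by the graph the value is constant. If the branch is cut by its weight, the
value exceeds 67. If it ends with a component closed, the value is a product whose first factor is
neither 1 nor bad, so it is not one of the bad primes. -/
theorem value_notMem_badCounts {col : V → Bool} (n : ℕ) :
    ∀ {k need u c L F R} {f : ℕ → V} {A : Finset (Sym2 V)} {D : Finset V},
    search n k need u c L F R = true → Explored col f A D k need u c L F → Phase f A D k u F R →
    value f A D L ∉ badCounts := by
  have hbad : ∀ x ∈ badCounts, x ≤ 67 ∧ x.Prime := by norm_num [badCounts]
  have hheavy : ∀ {k need u c L F} {f : ℕ → V} {A : Finset (Sym2 V)} {D : Finset V},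
      Explored col f A D k need u c L F → Nat.blt 67 (weight need L) = true →
      value f A D L ∉ badCounts := fun h hw hmem => by
    have h₁ := (hbad _ hmem).1
    have h₂ := h.weight_le
    rw [Nat.blt_eq] at hw
    lia
  induction n with
  | zero => intro k need u c L F R f A D hs; simp [search] at hs
  | succ n ih =>
    intro k need u c L F R f A D hs h hph
    rcases R with _ | _ | ⟨w, R⟩
    -- edges leaving `D`
    · rw [search, Bool.and_eq_true, Bool.or_eq_true] at hs
      by_cases hx : ∃ x ∉ D, s(f u, x) ∈ A
      · obtain ⟨x, hxD, hx⟩ := hx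
        obtain ⟨h', hv⟩ := h.half hx hxD (Explored.testBit_or_two_pow_eq_false need u)
        rw [← hv]
        exact hs.2.elim (hheavy h') fun hs => ih hs h' trivial
      · push Not at hx
        exact ih hs.1 h (h.phase_start fun x hxA => by_contra fun hxD => hx x hxD hxA)
    -- edges to unlabelled vertices, and the closing of `u`
    · rw [search_some_nil, Bool.and_eq_true, Bool.or_eq_true, Bool.or_eq_true] at hs
      by_cases hx : ∃ x, s(f u, x) ∈ A
      · obtain ⟨x, hx⟩ := hx
        obtain ⟨hxD, hxf⟩ := hph.2 x hx
        replace hxf := hxf.resolve_right (by simp)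
        obtain ⟨h', hv⟩ := h.extend hx hxD hxf (Explored.testBit_or_two_pow_eq_false need u)
        rw [← hv]
        refine hs.1.elim (hheavy h') fun hs => ih hs h' ⟨by simp, fun y hy => ?_⟩
        have hu : Function.update f k x u = f u := Function.update_of_ne h.u_lt.ne _ _
        rw [hu, mem_erase] at hy
        obtain ⟨hyD, hyf⟩ := hph.2 y hy.2
        refine ⟨hyD, .inl fun i hi => ?_⟩
        rcases Nat.lt_succ_iff_lt_or_eq.1 hi with hi | rfl
        · rw [Function.update_of_ne hi.ne]
          exact hyf.resolve_right (by simp) i hi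
        · rw [Function.update_self]
          rintro rfl
          exact hy.1 rfl
      · push Not at hx
        have hu : ∀ e ∈ A, f u ∉ e := by
          intro e he hue
          obtain ⟨y, rfl⟩ := hue
          exact hx y he
        have hneed : need.testBit u = true := by
          by_contra hneed
          obtain ⟨e, he, hue⟩ := h.edge (u, c) List.mem_cons_self (Bool.eq_false_iff.2 hneed)
          exact hu e he hue
        replace hs := hs.2.resolve_left (by simp [hneed])
        cases F with
        | nil =>
          simp only [Bool.not_eq_true', List.contains_eq_mem, decide_eq_false_iff_not] at hs
          rw [h.value_nil hu]
          intro hmem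
          rcases (Nat.prime_mul_iff.1 (hbad _ hmem).2) with ⟨-, h₁⟩ | ⟨-, h₁⟩
          · rw [h₁, mul_one] at hmem
            exact hs (List.mem_cons_of_mem 1 hmem)
          · rw [h₁] at hs
            exact hs List.mem_cons_self
        | cons w F =>
          rw [← h.value_keep hu]
          exact ih hs h.close trivial
    -- a possible edge to the label `w` of the queue
    · rw [search, Bool.and_eq_true, Bool.or_eq_true, Bool.or_eq_true] at hs
      have hw : w ∈ F := hph.1 List.mem_cons_self
      have hR : R ⊆ F := fun p hp => hph.1 (List.mem_cons_of_mem _ hp)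
      by_cases hx : s(f u, f w.1) ∈ A
      · obtain ⟨h', hv⟩ := h.join hw hx
        rw [← hv]
        have hcw : (c == w.2) ≠ true := by
          have := h.proper _ _ hx
          rw [h.u_color, h.color w (List.mem_cons_of_mem _ hw)] at this
          simpa using this
        replace hs := or_assoc.1 hs.2 |>.resolve_left hcw
        refine hs.elim (hheavy h') fun hs => ih hs h' ⟨hR, fun y hy => ?_⟩
        rw [mem_erase] at hy
        obtain ⟨hyD, hyf⟩ := hph.2 y hy.2
        refine ⟨hyD, hyf.imp_right ?_⟩
        rintro ⟨p, hp, rfl⟩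
        rcases List.mem_cons.1 hp with rfl | hp
        · exact absurd rfl hy.1
        · exact ⟨p, hp, rfl⟩
      · refine ih hs.1 h ⟨hR, fun y hy => ?_⟩
        obtain ⟨hyD, hyf⟩ := hph.2 y hy
        refine ⟨hyD, hyf.imp_right ?_⟩
        rintro ⟨p, hp, rfl⟩
        rcases List.mem_cons.1 hp with rfl | hp
        · exact absurd hy hx
        · exact ⟨p, hp, rfl⟩

end Explored

/-! ### Numbers that are not attained -/

section
variable {V : Type*} [DecidableEq V]

/-- The initial state, in which only `v` is labelled. -/
theorem explored_singleton {col : V → Bool} {A : Finset (Sym2 V)} {D : Finset V} {v : V}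
    (hA : ∀ a b, s(a, b) ∈ A → col a ≠ col b) (hD : ∀ v ∈ D, 2 ≤ #{e ∈ A | v ∈ e})
    (hv : v ∈ D) (hcol : col v = false) :
    Explored col (fun _ => v) A D 1 0 0 false [(0, 1)] [] where
  proper := hA
  mask_lt := by simp
  inj := by lia
  nodup := by simp
  lt := by simp
  mem := by simpa using hv
  color := by simpa using hcol
  edge := by
    have h₂ := hD v hv
    obtain ⟨e, he⟩ := card_pos.1 (by lia : 0 < #{e ∈ A | v ∈ e})
    simpa using ⟨e, mem_filter.1 he⟩
  active := by simp
  fresh w hw _ := hD w hw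

theorem value_singleton (f : ℕ → V) (A : Finset (Sym2 V)) (D : Finset V) :
    value f A D [(0, 1)] = coverCount A D := by
  simp [value, uncovered]

/-- Induction on `#D`. A vertex of `D` with at most one edge makes the count zero or forces that
edge, which reduces `D`; if there is no such vertex, the exploration applies. -/
theorem coverCount_notMem_badCounts {col : V → Bool} :
    ∀ (D : Finset V) (A : Finset (Sym2 V)), (∀ a b, s(a, b) ∈ A → col a ≠ col b) →
      coverCount A D ∉ badCounts := by
  intro D
  induction h : #D using Nat.strong_induction_on generalizing D with
  | _ n ih =>
  subst h
  intro A hA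
  have hmin : ∀ A' ⊆ A, ∀ D', #D' < #D → coverCount A' D' ∉ badCounts :=
    fun A' hA' D' hD' => ih _ hD' D' rfl A' fun a b hab => hA a b (hA' hab)
  rcases D.eq_empty_or_nonempty with rfl | ⟨v, hv⟩
  · rw [coverCount_empty_right]
    intro hmem
    have hodd : ∀ x ∈ badCounts, x ≠ 1 ∧ ¬ 2 ∣ x := by decide
    have h := hodd _ hmem
    cases hc : #A with
    | zero => simp [hc] at h
    | succ m => exact h.2 (hc ▸ dvd_pow_self 2 m.succ_ne_zero)
  by_cases hD : ∀ v ∈ D, 2 ≤ #{e ∈ A | v ∈ e}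
  · obtain ⟨e, he, e', he', hne⟩ := one_lt_card.1 (one_lt_two.trans_le (hD v hv))
    rw [mem_filter] at he he'
    -- recolour so that the starting vertex has colour `false`
    have hA' : ∀ a b, s(a, b) ∈ A → xor (col a) (col v) ≠ xor (col b) (col v) := by
      intro a b hab
      simpa using hA a b hab
    have h := explored_singleton hA' hD hv (by simp)
    have hneed : ∀ x, s(v, x) ∈ A → ∀ i, (0 : ℕ).testBit i = false →
        (0 : ℕ).testBit i = false ∧ (i = 0 → ∃ e ∈ A.erase s(v, x), v ∈ e) := by
      refine fun x hx i _ => ⟨Nat.zero_testBit i, fun _ => ?_⟩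
      obtain ⟨e, he, hne⟩ := exists_mem_ne (one_lt_two.trans_le (hD v hv)) s(v, x)
      rw [mem_filter] at he
      exact ⟨e, mem_erase.2 ⟨hne, he.1⟩, he.2⟩
    rw [← value_singleton (fun _ => v)]
    by_cases hx : ∃ x ∉ D, s(v, x) ∈ A
    · obtain ⟨x, hxD, hx⟩ := hx
      obtain ⟨h', hval⟩ := h.half hx hxD (hneed x hx)
      rw [← hval]
      exact value_notMem_badCounts 100 search_half h' trivial
    · push Not at hx
      obtain ⟨x, rfl⟩ := he.2
      have hvx : v ≠ x := by
        rintro rfl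
        exact hA _ _ he.1 rfl
      obtain ⟨h', hval⟩ := h.extend he.1 (by_contra fun hxD => hx x hxD he.1) (fun _ _ => hvx)
        (hneed x he.1)
      rw [← hval]
      refine value_notMem_badCounts 100 search_extend h' ⟨by simp, fun y hy => ?_⟩
      rw [Function.update_of_ne zero_ne_one, mem_erase] at hy
      refine ⟨by_contra fun hyD => hx y hyD hy.2, .inl fun i hi => ?_⟩
      have hvy : v ≠ y := by
        rintro rfl
        exact hA _ _ hy.2 rfl
      rw [Function.update_apply]
      split_ifs
      · rintro rfl
        exact hy.1 rfl
      · exact hvy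
  · push Not at hD
    obtain ⟨w, hw, hwA⟩ := hD
    have hzero : (0 : ℕ) ∉ badCounts := by decide
    by_cases hdeg : ∃ e ∈ A, w ∈ e
    · -- the only edge at `w` is forced
      obtain ⟨e, he, hwe⟩ := hdeg
      have hunique : ∀ e' ∈ A.erase e, w ∉ e' := by
        intro e' he' hwe'
        rw [mem_erase] at he'
        refine hwA.not_ge (one_lt_card.2 ⟨e, ?_, e', ?_, he'.1.symm⟩) <;> simp_all
      rw [coverCount_eq_add he, coverCount_eq_zero hw hunique, zero_add]
      exact hmin _ (erase_subset _ _) _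
        (card_lt_card ⟨filter_subset _ _, fun h => (mem_filter.1 (h hw)).2 hwe⟩)
    · push Not at hdeg
      rwa [coverCount_eq_zero hw hdeg]

end

theorem numEdgeCoverings_notMem {V : Type*} [Finite V] {G : SimpleGraph V} (hG : G.IsBipartite) :
    G.numEdgeCoverings ∉ ({19, 37, 41, 59, 67} : Set ℕ) := by
  classical
  have := Fintype.ofFinite V
  obtain ⟨col⟩ := hG
  have h := coverCount_notMem_badCounts (col := fun v => decide (col v = 0)) univ G.edgeFinset
    fun a b hab => by
      have h := col.valid (SimpleGraph.mem_edgeFinset.1 hab)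
      revert h
      generalize col a = i
      generalize col b = j
      revert i j
      decide
  rw [← numEdgeCoverings_eq_coverCount] at h
  simpa [badCounts] using h

/-! ### Rooted graphs and bridges between them -/

/-- `(t, n)` is realized by a connected bipartite graph with a root `r`: there are `n` edge
coverings, and `t` edge sets that cover all vertices except possibly `r`. The graph is given by its
edge set and a proper colouring in which the root has colour `false`. -/
def Realizable (p : ℕ × ℕ) : Prop :=
  ∃ (V : Type) (_ : Fintype V) (_ : DecidableEq V) (A : Finset (Sym2 V)) (col : V → Bool) (r : V),
    (∀ a b, s(a, b) ∈ A → col a ≠ col b) ∧ col r = false ∧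
    (∀ v, (SimpleGraph.fromEdgeSet (A : Set (Sym2 V))).Reachable r v) ∧
    coverCount A (univ.erase r) = p.1 ∧ coverCount A univ = p.2

/-- Reachability is preserved by an injective map that sends edges to edges. -/
theorem reachable_fromEdgeSet {V W : Type*} [DecidableEq W] {f : V → W}
    (hf : Function.Injective f) {A : Finset (Sym2 V)} {B : Finset (Sym2 W)}
    (h : A.image (Sym2.map f) ⊆ B) {a b : V}
    (hab : (SimpleGraph.fromEdgeSet (A : Set (Sym2 V))).Reachable a b) :
    (SimpleGraph.fromEdgeSet (B : Set (Sym2 W))).Reachable (f a) (f b) :=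
  hab.map ⟨f, fun {x y} hxy => by
    rw [SimpleGraph.fromEdgeSet_adj] at hxy ⊢
    exact ⟨h (mem_image_of_mem (Sym2.map f) hxy.1), hf.ne hxy.2⟩⟩

theorem Realizable.exists_graph {p : ℕ × ℕ} (h : Realizable p) :
    ∃ (m : ℕ) (G : SimpleGraph (Fin m)),
      G.IsBipartite ∧ G.Connected ∧ G.numEdgeCoverings = p.2 := by
  obtain ⟨V, _, _, A, col, r, hcol, -, hconn, -, hn⟩ := h
  let φ := Fintype.equivFin V
  let B : Finset (Sym2 (Fin (Fintype.card V))) := A.image (Sym2.map φ)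
  let G := SimpleGraph.fromEdgeSet (B : Set (Sym2 (Fin (Fintype.card V))))
  have hB : ∀ a b, s(a, b) ∈ B → col (φ.symm a) ≠ col (φ.symm b) := by
    intro a b hab
    obtain ⟨e, he, heq⟩ := mem_image.1 hab
    refine hcol _ _ ?_
    rw [← Sym2.map_mk, ← heq, Sym2.map_map]
    simpa using he
  have hcolor : ∀ a b, G.Adj a b → col (φ.symm a) ≠ col (φ.symm b) := fun a b hab =>
    hB a b ((SimpleGraph.fromEdgeSet_adj _).1 hab).1
  classical
  have hedge : G.edgeFinset = B := by
    ext e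
    induction e with
    | _ a b =>
    rw [SimpleGraph.mem_edgeFinset, SimpleGraph.mem_edgeSet, SimpleGraph.fromEdgeSet_adj, mem_coe,
      and_iff_left_iff_imp]
    rintro hab rfl
    exact hB _ _ hab rfl
  refine ⟨Fintype.card V, G, ?_, ?_, ?_⟩
  · exact (SimpleGraph.Coloring.mk (fun v => col (φ.symm v)) fun {a b} hab =>
      hcolor a b hab).colorable
  · have : Nonempty (Fin (Fintype.card V)) := ⟨φ r⟩
    refine SimpleGraph.Connected.mk fun a b => ?_
    have hreach : ∀ a, G.Reachable (φ r) a := fun a => by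
      simpa using reachable_fromEdgeSet φ.injective (subset_refl B) (hconn (φ.symm a))
    exact (hreach a).symm.trans (hreach b)
  · rw [numEdgeCoverings_eq_coverCount, hedge, ← image_univ_equiv φ,
      coverCount_image φ.injective, hn]

/-- The effect on the pair of counts of connecting the roots of two graphs by a new edge, where the
root of the first graph is kept: with the edge, neither root needs another one. Written `p ⋈ q`. -/
def bridge (p q : ℕ × ℕ) : ℕ × ℕ := (p.1 * (q.1 + q.2), p.1 * q.1 + p.2 * q.2)

infixr:70 " ⋈ " => bridge

/-- Connecting the roots of disjoint realizations by an edge, with the colours of the second graph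
exchanged. -/
theorem Realizable.bridge {p q : ℕ × ℕ} (hp : Realizable p) (hq : Realizable q) :
    Realizable (p ⋈ q) := by
  obtain ⟨V, _, _, A, col, r, hcol, hr, hconn, ht, hn⟩ := hp
  obtain ⟨V', _, _, A', col', r', hcol', hr', hconn', ht', hn'⟩ := hq
  set B : Finset (Sym2 (V ⊕ V')) := A.image (Sym2.map Sum.inl) with hB
  set B' : Finset (Sym2 (V ⊕ V')) := A'.image (Sym2.map Sum.inr) with hB'
  -- the edges of either part lie on its own side
  have hBr : ∀ e ∈ B, ∀ v, Sum.inr v ∉ e := by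
    intro e he v hv
    obtain ⟨e, -, rfl⟩ := mem_image.1 he
    simpa using Sym2.mem_map.1 hv
  have hBl : ∀ e ∈ B', ∀ v, Sum.inl v ∉ e := by
    intro e he v hv
    obtain ⟨e, -, rfl⟩ := mem_image.1 he
    simpa using Sym2.mem_map.1 hv
  have hdisj : Disjoint B B' := by
    refine disjoint_left.2 fun e he he' => ?_
    obtain ⟨v, hv⟩ : ∃ v, v ∈ e := ⟨e.out.1, Sym2.out_fst_mem e⟩
    cases v with
    | inl v => exact hBl e he' v hv
    | inr v => exact hBr e he v hv
  have hprod : ∀ (D : Finset V) (D' : Finset V'),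
      coverCount (B ∪ B') (D.image Sum.inl ∪ D'.image Sum.inr) =
        coverCount A D * coverCount A' D' := by
    intro D D'
    rw [coverCount_union hdisj, coverCount_image Sum.inl_injective,
      coverCount_image Sum.inr_injective]
    · rintro e he v hv
      obtain ⟨v, -, rfl⟩ := mem_image.1 hv
      exact hBr e he v
    · rintro e he v hv
      obtain ⟨v, -, rfl⟩ := mem_image.1 hv
      exact hBl e he v
  have hnew : s(Sum.inl r, Sum.inr r') ∉ B ∪ B' := by
    rw [mem_union]
    rintro (h | h)
    · exact hBr _ h r' (Sym2.mem_mk_right ..)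
    · exact hBl _ h r (Sym2.mem_mk_left ..)
  have hdec : ∀ (D : Finset V) (D' : Finset V'),
      coverCount (insert s(Sum.inl r, Sum.inr r') (B ∪ B')) (D.image Sum.inl ∪ D'.image Sum.inr) =
        coverCount A D * coverCount A' D' +
          coverCount A (D.erase r) * coverCount A' (D'.erase r') := by
    intro D D'
    rw [coverCount_eq_add (mem_insert_self _ _), erase_insert hnew, hprod, ← hprod (D.erase r)]
    congr 2
    ext v
    cases v <;> simp [and_comm]
  have huniv : (univ : Finset (V ⊕ V')) = univ.image Sum.inl ∪ univ.image Sum.inr := by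
    ext v
    cases v <;> simp
  have herase : (univ.erase (Sum.inl r) : Finset (V ⊕ V')) =
      (univ.erase r).image Sum.inl ∪ univ.image Sum.inr := by
    ext v
    cases v <;> simp
  refine ⟨V ⊕ V', inferInstance, inferInstance, insert s(Sum.inl r, Sum.inr r') (B ∪ B'),
    Sum.elim col fun v => !col' v, Sum.inl r, ?_, hr, ?_, ?_, ?_⟩
  · have hsymm : ∀ e ∈ insert s(Sum.inl r, Sum.inr r') (B ∪ B'), ∀ a b, e = s(a, b) →
        Sum.elim col (fun v => !col' v) a ≠ Sum.elim col (fun v => !col' v) b := by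
      intro e he a b hab
      rw [mem_insert, mem_union] at he
      rcases he with rfl | he | he
      · rcases Sym2.eq_iff.1 hab with ⟨rfl, rfl⟩ | ⟨rfl, rfl⟩ <;> simp [hr, hr']
      · obtain ⟨⟨x, y⟩, hxy, rfl⟩ := mem_image.1 he
        rcases Sym2.eq_iff.1 hab with ⟨rfl, rfl⟩ | ⟨rfl, rfl⟩
        · exact hcol _ _ hxy
        · exact (hcol _ _ hxy).symm
      · obtain ⟨⟨x, y⟩, hxy, rfl⟩ := mem_image.1 he
        rcases Sym2.eq_iff.1 hab with ⟨rfl, rfl⟩ | ⟨rfl, rfl⟩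
        · simpa using hcol' _ _ hxy
        · simpa using (hcol' _ _ hxy).symm
    exact fun a b hab => hsymm _ hab a b rfl
  · have hl : ∀ v, (SimpleGraph.fromEdgeSet ((insert s(Sum.inl r, Sum.inr r') (B ∪ B') :
        Finset (Sym2 (V ⊕ V'))) : Set (Sym2 (V ⊕ V')))).Reachable
          (Sum.inl r) (Sum.inl v) := fun v =>
      reachable_fromEdgeSet Sum.inl_injective (subset_union_left.trans (subset_insert _ _))
        (hconn v)
    have hr : ∀ v, (SimpleGraph.fromEdgeSet ((insert s(Sum.inl r, Sum.inr r') (B ∪ B') :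
        Finset (Sym2 (V ⊕ V'))) : Set (Sym2 (V ⊕ V')))).Reachable
          (Sum.inr r') (Sum.inr v) := fun v =>
      reachable_fromEdgeSet Sum.inr_injective (subset_union_right.trans (subset_insert _ _))
        (hconn' v)
    rintro (v | v)
    · exact hl v
    · refine SimpleGraph.Reachable.trans (SimpleGraph.Adj.reachable ?_) (hr v)
      rw [SimpleGraph.fromEdgeSet_adj]
      exact ⟨mem_coe.2 (mem_insert_self _ _), by simp⟩
  · rw [herase, hdec]
    simp only [erase_idem, ht, hn', ht', _root_.bridge, mul_add]
    ring
  · rw [huniv, hdec, ht, hn, ht', hn', _root_.bridge]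
    ring

theorem realizable_vertex : Realizable (1, 0) :=
  ⟨Unit, inferInstance, inferInstance, ∅, fun _ => false, (), by simp, rfl,
    fun _ => SimpleGraph.Reachable.refl _, by simp [coverCount_empty_left],
    by simp [coverCount_empty_left]⟩

/-- The number of sublists of the edge list `l` that cover `D`, by deletion–contraction; it is
written for evaluation in the kernel. -/
def listCount {m : ℕ} : List (Fin m × Fin m) → Finset (Fin m) → ℕ
  | [], D => bif D.card.beq 0 then 1 else 0
  | e :: l, D => listCount l D + listCount l ((D.erase e.1).erase e.2)

theorem coverCount_toFinset {m : ℕ} (l : List (Fin m × Fin m)) (D : Finset (Fin m))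
    (hl : (l.map fun e => s(e.1, e.2)).Nodup) :
    coverCount (l.map fun e => s(e.1, e.2)).toFinset D = listCount l D := by
  induction l generalizing D with
  | nil =>
    rw [listCount, List.map_nil, List.toFinset_nil, coverCount_empty_left, cond_eq_ite]
    simp
  | cons e l ih =>
    rw [List.map_cons, List.nodup_cons] at hl
    rw [listCount, List.map_cons, List.toFinset_cons, coverCount_eq_add (mem_insert_self _ _),
      erase_insert (by rw [List.mem_toFinset]; exact hl.1), ih _ hl.2, ih _ hl.2]
    congr 2
    ext v
    rw [mem_filter, mem_erase, mem_erase, Sym2.mem_iff]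
    tauto

/-- The edge list `l` on `Fin (m + 1)` is a certificate that `p` is realizable, with root `0`. The
bits of `c` are a proper colouring. Connectedness is witnessed by an edge `(a, v)` with `a < v` for
each `v ≠ 0`. -/
def IsGadget (m : ℕ) (l : List (Fin (m + 1) × Fin (m + 1))) (c : ℕ) (p : ℕ × ℕ) : Prop :=
  (l.map fun e => s(e.1, e.2)).Nodup ∧
    (∀ e ∈ l, c.testBit e.1 ≠ c.testBit e.2) ∧ c.testBit 0 = false ∧
    (∀ v : Fin (m + 1), v ≠ 0 → ∃ e ∈ l, e.1 < v ∧ e.2 = v) ∧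
    listCount l (univ.erase 0) = p.1 ∧ listCount l univ = p.2

instance (m : ℕ) (l : List (Fin (m + 1) × Fin (m + 1))) (c : ℕ) (p : ℕ × ℕ) :
    Decidable (IsGadget m l c p) := by
  unfold IsGadget
  infer_instance

theorem IsGadget.realizable {m : ℕ} {l : List (Fin (m + 1) × Fin (m + 1))} {c : ℕ} {p : ℕ × ℕ}
    (h : IsGadget m l c p) : Realizable p := by
  obtain ⟨hl, hc, h0, hconn, ht, hn⟩ := h
  have hcol : ∀ a b : Fin (m + 1), s(a, b) ∈ (l.map fun e => s(e.1, e.2)).toFinset →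
      c.testBit a ≠ c.testBit b := by
    intro a b hab
    rw [List.mem_toFinset, List.mem_map] at hab
    obtain ⟨⟨x, y⟩, hxy, heq⟩ := hab
    rcases Sym2.eq_iff.1 heq with ⟨rfl, rfl⟩ | ⟨rfl, rfl⟩
    · exact hc _ hxy
    · exact (hc _ hxy).symm
  refine ⟨Fin (m + 1), inferInstance, inferInstance, (l.map fun e => s(e.1, e.2)).toFinset,
    fun v => c.testBit v, 0, hcol, h0, fun v => ?_, ?_, ?_⟩
  · induction v using WellFoundedLT.induction with
    | _ v ih =>
    by_cases hv : v = 0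
    · rw [hv]
    · obtain ⟨⟨x, y⟩, he, hx, rfl⟩ := hconn v hv
      refine (ih x hx).trans (SimpleGraph.Adj.reachable ?_)
      rw [SimpleGraph.fromEdgeSet_adj]
      exact ⟨mem_coe.2 (List.mem_toFinset.2 (List.mem_map.2 ⟨_, he, rfl⟩)), hx.ne⟩
  · rw [coverCount_toFinset _ _ hl, ht]
  · rw [coverCount_toFinset _ _ hl, hn]

/-! ### Numbers that are attained -/

section
variable {M : List (ℕ × ℕ)}

/-- The numbers of coverings, as the bits of one number, that are obtained from `p` by bridging
graphs from `M` to it up to `k - 1` times, and then attaching a leaf or not: by bridging a path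
with two vertices, `p` becomes a pair with `p.1 + p.2` coverings. Intermediate counts above 1000
are discarded. -/
def reach (M : List (ℕ × ℕ)) : ℕ → ℕ × ℕ → ℕ
  | 0, _ => 0
  | k + 1, p => bif Nat.ble p.2 1000 then
      M.foldl (fun b q => b ||| reach M k (q ⋈ p)) (2 ^ p.2 ||| 2 ^ (p.1 + p.2)) else 0

theorem testBit_foldl_or {α : Type*} (g : α → ℕ) (l : List α) (b n : ℕ)
    (h : (l.foldl (fun b q => b ||| g q) b).testBit n = true) :
    b.testBit n = true ∨ ∃ q ∈ l, (g q).testBit n = true := by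
  induction l generalizing b with
  | nil => exact .inl h
  | cons a l ih =>
    rcases ih _ h with h | ⟨q, hq, h⟩
    · rw [Nat.testBit_or, Bool.or_eq_true] at h
      exact h.imp_right fun h => ⟨a, List.mem_cons_self, h⟩
    · exact .inr ⟨q, List.mem_cons_of_mem _ hq, h⟩

theorem realizable_one_one : Realizable (1, 1) :=
  realizable_vertex.bridge realizable_vertex

theorem Realizable.of_testBit_reach (hM : ∀ q ∈ M, Realizable q) {k : ℕ} {p : ℕ × ℕ} {n : ℕ}
    (hp : Realizable p) (h : (reach M k p).testBit n = true) : ∃ t, Realizable (t, n) := by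
  induction k generalizing p with
  | zero => simp [reach] at h
  | succ k ih =>
    rw [reach, cond_eq_ite] at h
    split_ifs at h with hle
    · rcases testBit_foldl_or _ _ _ _ h with h | ⟨q, hq, h⟩
      · rw [Nat.testBit_or, Nat.testBit_two_pow, Nat.testBit_two_pow, Bool.or_eq_true,
          decide_eq_true_eq, decide_eq_true_eq] at h
        rcases h with rfl | rfl
        · exact ⟨p.1, hp⟩
        · have hleaf : (1, 1) ⋈ p = (p.1 + p.2, p.1 + p.2) := by simp [_root_.bridge]
          exact ⟨p.1 + p.2, hleaf ▸ realizable_one_one.bridge hp⟩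
      · exact ih ((hM q hq).bridge hp) h
    · simp at h

end

/-- Start values of the closure under bridging; together with three multipliers they yield all
counts that are claimed. -/
def seeds : List (ℕ × ℕ) :=
  [(1, 1), (2, 1), (3, 2), (8, 7), (12, 11), (5, 5), (4, 4), (7, 4) ⋈ (1, 0), (1, 1) ⋈ (7, 4),
    (16, 15), (9, 8) ⋈ (1, 1), (6, 3), (17, 15), (38, 31), (9, 8) ⋈ (2, 1), (5, 3) ⋈ (3, 2),
    (32, 25), (1, 1) ⋈ (12, 11), (28, 23), (26, 23), (7, 4) ⋈ (7, 4), (4, 3) ⋈ (5, 3),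
    (12, 11) ⋈ (8, 5), (8, 5) ⋈ (5, 3), (4, 3) ⋈ (8, 5), (4, 3) ⋈ (3, 2),
    ((2, 1) ⋈ (8, 7)) ⋈ (5, 5), (112, 89), (8, 7) ⋈ (5, 5), (8, 7) ⋈ (4, 3), (8, 5) ⋈ (4, 3),
    (17, 15) ⋈ (2, 1), (5, 5) ⋈ (4, 3), (46, 39) ⋈ (2, 1), ((9, 8) ⋈ (1, 1)) ⋈ (8, 7),
    (4, 3) ⋈ (7, 4) ⋈ (3, 2), ((38, 31) ⋈ (1, 1)) ⋈ (2, 1), ((1, 1) ⋈ (8, 5)) ⋈ (8, 5),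
    ((28, 23) ⋈ (1, 1)) ⋈ (1, 1), ((7, 4) ⋈ (1, 0)) ⋈ (7, 4), (4, 3) ⋈ (7, 4) ⋈ (1, 0),
    (((12, 11) ⋈ (2, 1)) ⋈ (2, 1)) ⋈ (2, 1), (62, 49), (26, 25), ((26, 25) ⋈ (1, 1)) ⋈ (1, 1),
    (100, 77) ⋈ (2, 1), (100, 77), (12, 11) ⋈ (28, 23), (16, 15) ⋈ (26, 25), (12, 11) ⋈ (26, 25),
    (32, 25) ⋈ (9, 8), (8, 7) ⋈ (62, 49), (12, 11) ⋈ (38, 31), (16, 15) ⋈ (16, 15),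
    (32, 25) ⋈ (8, 7), (12, 11) ⋈ (12, 11), (28, 23) ⋈ (5, 5), (16, 15) ⋈ (8, 5),
    (4, 3) ⋈ (16, 15), (5, 5) ⋈ (9, 8), (5, 3) ⋈ (8, 7), (28, 23) ⋈ (1, 1), (16, 15) ⋈ (1, 1),
    ((1, 0) ⋈ (16, 15)) ⋈ (16, 15), (12, 11) ⋈ (2, 1) ⋈ (8, 7), (9, 8) ⋈ (1, 0) ⋈ (28, 23),
    ((16, 15) ⋈ (2, 1)) ⋈ (2, 1), (8, 7) ⋈ (3, 2) ⋈ (1, 1), (1, 1) ⋈ (8, 5) ⋈ (1, 1),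
    (16, 15) ⋈ (1, 0) ⋈ (1, 0) ⋈ (8, 7), (((28, 23) ⋈ (1, 1)) ⋈ (1, 1)) ⋈ (1, 1),
    (8, 7) ⋈ (1, 0) ⋈ (1, 0) ⋈ (1, 0) ⋈ (17, 15), (94, 89), (100, 86), (61, 51), (53, 51),
    (39, 33), (818, 811)]

theorem realizable_of_mem_seeds : ∀ p ∈ seeds, Realizable p := by
  -- trees
  have hv := realizable_vertex
  have h1_1 := realizable_one_one
  have h2_1 : Realizable (2, 1) := hv.bridge h1_1
  have h3_2 : Realizable (3, 2) := hv.bridge h2_1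
  have h4_3 : Realizable (4, 3) := h2_1.bridge h1_1
  have h5_3 : Realizable (5, 3) := hv.bridge h3_2
  have h8_7 : Realizable (8, 7) := h4_3.bridge h1_1
  have h16_15 : Realizable (16, 15) := h8_7.bridge h1_1
  have h7_4 : Realizable (7, 4) := hv.bridge h4_3
  have h2_2 : Realizable (2, 2) := h1_1.bridge h1_1
  have h4_4 : Realizable (4, 4) := h2_2.bridge h1_1
  have h5_5 : Realizable (5, 5) := h1_1.bridge h3_2
  have h8_5 : Realizable (8, 5) := hv.bridge h5_3
  have h9_8 : Realizable (9, 8) := h3_2.bridge h2_1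
  have h3_3 : Realizable (3, 3) := h1_1.bridge h2_1
  have h6_3 : Realizable (6, 3) := hv.bridge h3_3
  have h6_5 : Realizable (6, 5) := h3_2.bridge h1_1
  have h12_11 : Realizable (12, 11) := h6_5.bridge h1_1
  -- graphs with cycles
  have h17_15 : Realizable (17, 15) := IsGadget.realizable (m := 5) (c := 26)
    (l := [(0, 1), (1, 2), (2, 3), (0, 3), (2, 4), (4, 5)]) (by decide +kernel)
  have h26_23 : Realizable (26, 23) := IsGadget.realizable (m := 6) (c := 90)
    (l := [(0, 1), (1, 2), (2, 3), (0, 3), (2, 4), (4, 5), (5, 6)]) (by decide +kernel)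
  have h26_25 : Realizable (26, 25) := IsGadget.realizable (m := 4) (c := 14)
    (l := [(0, 1), (0, 2), (0, 3), (1, 4), (2, 4), (3, 4)]) (by decide +kernel)
  have h28_23 : Realizable (28, 23) := IsGadget.realizable (m := 6) (c := 42)
    (l := [(0, 1), (1, 2), (2, 3), (0, 3), (3, 4), (4, 5), (5, 6)]) (by decide +kernel)
  have h32_25 : Realizable (32, 25) := IsGadget.realizable (m := 4) (c := 18)
    (l := [(0, 1), (1, 2), (1, 3), (0, 4), (2, 4), (3, 4)]) (by decide +kernel)
  have h38_31 : Realizable (38, 31) := IsGadget.realizable (m := 7) (c := 170)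
    (l := [(0, 1), (1, 2), (2, 3), (0, 3), (3, 4), (4, 5), (3, 6), (6, 7)]) (by decide +kernel)
  have h39_33 : Realizable (39, 33) := IsGadget.realizable (m := 7) (c := 154)
    (l := [(0, 1), (1, 2), (2, 3), (0, 3), (2, 4), (4, 5), (3, 6), (6, 7)]) (by decide +kernel)
  have h46_39 : Realizable (46, 39) := IsGadget.realizable (m := 7) (c := 170)
    (l := [(0, 1), (1, 2), (2, 3), (3, 4), (4, 5), (0, 5), (3, 6), (6, 7)]) (by decide +kernel)
  have h53_51 : Realizable (53, 51) := IsGadget.realizable (m := 6) (c := 46)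
    (l := [(0, 1), (0, 2), (0, 3), (1, 4), (2, 4), (3, 4), (4, 5), (5, 6)]) (by decide +kernel)
  have h61_51 : Realizable (61, 51) := IsGadget.realizable (m := 6) (c := 42)
    (l := [(0, 1), (1, 2), (2, 3), (3, 4), (4, 5), (0, 5), (1, 4), (3, 6)]) (by decide +kernel)
  have h62_49 : Realizable (62, 49) := IsGadget.realizable (m := 8) (c := 170)
    (l := [(0, 1), (1, 2), (2, 3), (0, 3), (1, 4), (4, 5), (3, 6), (6, 7), (7, 8)])
    (by decide +kernel)
  have h94_89 : Realizable (94, 89) := IsGadget.realizable (m := 7) (c := 78)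
    (l := [(0, 1), (0, 2), (0, 3), (1, 4), (2, 4), (3, 4), (3, 5), (5, 6), (6, 7)])
    (by decide +kernel)
  have h100_77 : Realizable (100, 77) := IsGadget.realizable (m := 7) (c := 82)
    (l := [(0, 1), (1, 2), (1, 3), (0, 4), (2, 4), (3, 4), (4, 5), (5, 6), (6, 7)])
    (by decide +kernel)
  have h100_86 : Realizable (100, 86) := IsGadget.realizable (m := 9) (c := 426)
    (l := [(0, 1), (1, 2), (2, 3), (3, 4), (4, 5), (0, 5), (3, 6), (6, 7), (4, 8),
      (8, 9)])
    (by decide +kernel)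
  have h112_89 : Realizable (112, 89) := IsGadget.realizable (m := 7) (c := 178)
    (l := [(0, 1), (1, 2), (1, 3), (0, 4), (2, 4), (3, 4), (3, 5), (5, 6), (6, 7)])
    (by decide +kernel)
  have h818_811 : Realizable (818, 811) := IsGadget.realizable (m := 8) (c := 62)
    (l := [(0, 1), (0, 2), (0, 3), (0, 4), (0, 5), (1, 6), (1, 7), (1, 8), (2, 6),
      (3, 6), (4, 7), (5, 8)])
    (by decide +kernel)
  simp only [seeds, List.forall_mem_cons, List.not_mem_nil, false_imp_iff, implies_true,
    and_true]
  repeat' first | assumption | apply And.intro | apply Realizable.bridge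

/-- The numbers up to 1000 that the construction is not claimed to reach. -/
def exceptions : List ℕ := [0, 19, 37, 41, 59, 67, 82, 97, 149, 197, 223, 257, 291, 379]

/-- The bits of the closure of `seeds` together with `exceptions` fill the range from 0 to 1000. -/
theorem reach_seeds :
    Nat.beq (exceptions.foldl (fun b n => b ||| 2 ^ n)
        (seeds.foldl (fun b p => b ||| reach [(1, 0), (2, 1), (3, 2)] 20 p) 0) %
      2 ^ 1001) (2 ^ 1001 - 1) = true := by
  decide +kernel

theorem exists_realizable {n : ℕ} (hn : n ≤ 1000) (h : n ∉ exceptions) :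
    ∃ t, Realizable (t, n) := by
  have hbit := congrArg (·.testBit n) (Nat.eq_of_beq_eq_true reach_seeds)
  simp only [Nat.testBit_mod_two_pow, Nat.testBit_two_pow_sub_one] at hbit
  rw [decide_eq_true (by lia : n < 1001), Bool.true_and] at hbit
  rcases testBit_foldl_or (2 ^ ·) _ _ _ hbit with hbit | ⟨m, hm, hbit⟩
  · rcases testBit_foldl_or _ _ _ _ hbit with hbit | ⟨p, hp, hbit⟩
    · simp at hbit
    · refine (realizable_of_mem_seeds p hp).of_testBit_reach (fun q hq => ?_) hbit
      have hsub : ∀ q ∈ [(1, 0), (2, 1), (3, 2)], q = (1, 0) ∨ q ∈ seeds := by decide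
      rcases hsub q hq with rfl | hq
      · exact realizable_vertex
      · exact realizable_of_mem_seeds q hq
  · rw [Nat.testBit_two_pow, decide_eq_true_eq] at hbit
    exact absurd (hbit ▸ hm) h

theorem mainTheorem1 :
    (∀ (V : Type*) [Finite V] (G : SimpleGraph V), G.IsBipartite →
      G.numEdgeCoverings ∉ ({19, 37, 41, 59, 67} : Set ℕ)) ∧
    (∀ n : ℕ, 1 ≤ n → n ≤ 1000 →
      n ∉ ({19, 37, 41, 59, 67, 82, 97, 149, 197, 223, 257, 291, 379} : Set ℕ) →
      ∃ (m : ℕ) (G : SimpleGraph (Fin m)),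
        G.IsBipartite ∧ G.Connected ∧ G.numEdgeCoverings = n) := by
  refine ⟨fun V _ G hG => numEdgeCoverings_notMem hG, fun n h₁ h₂ hn => ?_⟩
  have hmem : n ∉ exceptions := by
    simp only [exceptions, List.mem_cons, List.not_mem_nil, or_false, Set.mem_insert_iff,
      Set.mem_singleton_iff, not_or] at hn ⊢
    exact ⟨by lia, hn⟩
  obtain ⟨t, ht⟩ := exists_realizable h₂ hmem
  exact ht.exists_graph
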